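/- Let $S$ be a finite set of qubits, partitioned in two ways, $S=A\sqcup B=C\sqcup D$, so that $\mathcal H_S=\mathcal H_A\otimes\mathcal H_B=\mathcal H_C\otimes\mathcal H_D$, and let $\overline B$ be a copy of $B$. Let $U$ be a Clifford unitary on $\mathcal H_S$: for every Pauli operator $P$ (a tensor product of the single-qubit matrices $I,X,Y,Z$), $UPU^\dagger$ is a Pauli operator up to a phase. Put $d_B=2^{|B|}$, $|\mathrm{EPR}\rangle_{B\overline B}=d_B^{-1/2}\sum_{j}|j\rangle_B\otimes|j\rangle_{\overline B}$, let $\Gamma:\mathcal H_A\to\mathcal H_C\otimes\mathcal H_D\otimes\mathcal H_{\overline B}$ be the isometry $$\Gamma|\psi\rangle=(U\otimes I_{\overline B})\big(|\psi\rangle_A\otimes|\mathrm{EPR}\rangle_{B\overline B}\big),$$ and let $\mathcal N(\sigma)=\mathrm{Tr}_C(\Gamma\sigma\Gamma^\dagger)$, a map from operators on $\mathcal H_A$ to operators on $\mathcal H_D\otimes\mathcal H_{\overline B}$. For a Pauli operator $P_A$ on $A$, taken up to phase, write $$U(P_A\otimes I_B)U^\dagger=e^{i\theta}\,\Lambda_C(P_A)\otimes\Lambda_D(P_A)$$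 with Pauli operators $\Lambda_C(P_A)$ on $C$ and $\Lambda_D(P_A)$ on $D$; these are unique up to phase. This defines the forward time-evolution map $\Lambda_D:\mathrm{Pauli}_A\to\mathrm{Pauli}_D$ between Pauli operators up to phase. Then the following are equivalent: 1. (Perfect recovery.) There is a quantum channel (completely positive trace-preserving linear map) $\mathcal R$ from operators on $\mathcal H_D\otimes\mathcal H_{\overline B}$ to operators on $\mathcal H_A$ such that $\mathcal R(\mathcal N(\sigma))=\sigma$ for every density operator $\sigma$ on $\mathcal H_A$. 2. $\Lambda_D$ is injective. -/

import Mathlib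

open scoped Matrix Kronecker ComplexOrder

noncomputable section

/-- Labels of the computational basis of a register whose qubits are labelled by `S`;
the Hilbert space of the register has dimension `2 ^ |S|`. -/
abbrev Bits (S : Type*) : Type _ := S → Fin 2

/-- Operators (in the computational basis) on the register with qubit set `S`. -/
abbrev Op (S : Type*) : Type _ := Matrix (Bits S) (Bits S) ℂ

/-- Labels of the four single-qubit Pauli operators. -/
inductive Pauli : Type
  | I | X | Y | Z

/-- The single-qubit Pauli matrices. -/
def Pauli.mat : Pauli → Matrix (Fin 2) (Fin 2) ℂ
  | .I => !![1, 0; 0, 1]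
  | .X => !![0, 1; 1, 0]
  | .Y => !![0, -Complex.I; Complex.I, 0]
  | .Z => !![1, 0; 0, -1]

/-- The Pauli operators on the qubits `S`, up to phase: one single-qubit Pauli for each qubit. -/
abbrev PauliString (S : Type*) : Type _ := S → Pauli

/-- The tensor product of the single-qubit Pauli matrices of a Pauli string. -/
def PauliString.op {S : Type*} [Fintype S] (p : PauliString S) : Op S :=
  Matrix.of fun x y => ∏ s, (p s).mat (x s) (y s)

/-- `PhaseEq M N`: equality of `M` and `N` up to a `U(1)` phase factor. -/
def PhaseEq {m n : Type*} (M N : Matrix m n ℂ) : Prop :=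
  ∃ c : ℂ, ‖c‖ = 1 ∧ M = c • N

/-- A Clifford operator: a unitary that conjugates every Pauli operator to a Pauli operator,
up to a phase. -/
def IsClifford {S : Type*} [Fintype S] [DecidableEq S] (U : Op S) : Prop :=
  U ∈ Matrix.unitaryGroup (Bits S) ℂ ∧
    ∀ p : PauliString S, ∃ q : PauliString S, PhaseEq (U * p.op * Uᴴ) q.op

/-- A partition `e : K ⊕ L ≃ S` of the qubits `S` into two registers `K` and `L` splits each
basis label of `S` into a pair. -/
def splitBits {K L S : Type*} (e : K ⊕ L ≃ S) : Bits S ≃ Bits K × Bits L :=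
  (Equiv.arrowCongr e.symm (Equiv.refl (Fin 2))).trans (Equiv.sumArrowEquivProdArrow K L (Fin 2))

/-- The Pauli string `p ⊗ q` on `S = K ⊔ L`. -/
def PauliString.tensor {K L S : Type*} (e : K ⊕ L ≃ S) (p : PauliString K) (q : PauliString L) :
    PauliString S :=
  fun s => Sum.elim p q (e.symm s)

/-- The identity Pauli string. -/
def PauliString.id (S : Type*) : PauliString S := fun _ => Pauli.I

theorem PauliString.op_id (S : Type*) [Fintype S] [DecidableEq S] :
    (PauliString.id S).op = 1 := by
  have h : Pauli.I.mat = 1 := by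
    ext i j; fin_cases i <;> fin_cases j <;> simp [Pauli.mat]
  ext x y
  simp only [PauliString.op, PauliString.id, h, Matrix.of_apply, Matrix.one_apply]
  by_cases hxy : x = y
  · simp [hxy]
  · obtain ⟨s, hs⟩ := Function.ne_iff.1 hxy
    rw [if_neg hxy]
    exact Finset.prod_eq_zero (Finset.mem_univ s) (if_neg hs)

theorem PauliString.op_tensor {K L S : Type*} [Fintype K] [Fintype L] [Fintype S]
    (e : K ⊕ L ≃ S) (p : PauliString K) (q : PauliString L) :
    Matrix.reindex (splitBits e) (splitBits e) (PauliString.tensor e p q).op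
      = p.op ⊗ₖ q.op := by
  ext ⟨x₁, x₂⟩ ⟨y₁, y₂⟩
  simp only [Matrix.reindex_apply, Matrix.submatrix_apply, PauliString.op, Matrix.of_apply,
    Matrix.kroneckerMap_apply]
  rw [← Equiv.prod_comp e, Fintype.prod_sum_type]
  simp [PauliString.tensor, splitBits, Equiv.sumArrowEquivProdArrow]

/-- Distinct Pauli strings are not proportional, so the string of a Pauli operator
is determined by the operator up to phase. -/
theorem PauliString.eq_of_phaseEq {S : Type*} [Fintype S] [DecidableEq S] {M : Op S}
    {p q : PauliString S} (hp : PhaseEq M p.op) (hq : PhaseEq M q.op) : p = q := by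
  have key : ∀ a b : PauliString S,
      (a.op * b.op).trace = ∏ s, ((a s).mat * (b s).mat).trace := by
    intro a b
    simp only [Matrix.trace, Matrix.diag, Matrix.mul_apply, PauliString.op, Matrix.of_apply,
      ← Finset.prod_mul_distrib]
    rw [Fintype.prod_sum]
    refine Finset.sum_congr rfl fun x _ => ?_
    rw [Fintype.prod_sum]
  have hne : ∀ a b : Pauli, a ≠ b → (a.mat * b.mat).trace = 0 := by
    intro a b h
    cases a <;> cases b <;> first | exact absurd rfl h | simp [Pauli.mat, Matrix.trace_fin_two]
  have hself : ∀ a : Pauli, (a.mat * a.mat).trace = 2 := by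
    intro a
    cases a <;> simp [Pauli.mat, Matrix.trace_fin_two] <;> norm_num
  by_contra h
  obtain ⟨s, hs⟩ := Function.ne_iff.1 h
  obtain ⟨c, hc, h1⟩ := hp
  obtain ⟨c', -, h2⟩ := hq
  have h0 : (p.op * q.op).trace = 0 := by
    rw [key]; exact Finset.prod_eq_zero (Finset.mem_univ s) (hne _ _ hs)
  have h3 : (p.op * p.op).trace ≠ 0 := by
    rw [key]; exact Finset.prod_ne_zero_iff.2 fun i _ => by rw [hself]; norm_num
  have h4 : c * (p.op * p.op).trace = c' * (p.op * q.op).trace := by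
    have := congrArg (fun N => (p.op * N).trace) (h1.symm.trans h2)
    simpa using this
  rw [h0, mul_zero] at h4
  have hc0 : c ≠ 0 := by rintro rfl; simp at hc
  exact (mul_ne_zero hc0 h3) h4

/-- The Pauli string of `U p U†`, for a Clifford `U`. -/
def evolve {S : Type*} [Fintype S] [DecidableEq S] {U : Op S} (hU : IsClifford U)
    (p : PauliString S) : PauliString S :=
  (hU.2 p).choose

theorem evolve_spec {S : Type*} [Fintype S] [DecidableEq S] {U : Op S} (hU : IsClifford U)
    (p : PauliString S) : PhaseEq (U * p.op * Uᴴ) (evolve hU p).op :=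
  (hU.2 p).choose_spec

section ForwardMap

variable {S A B C D : Type*} [Fintype S] [DecidableEq S]

/-- The `C`-part of the time-evolved Pauli operator `U (p ⊗ I_B) U†`. -/
def forwardMapC (eAB : A ⊕ B ≃ S) (eCD : C ⊕ D ≃ S) {U : Op S} (hU : IsClifford U)
    (p : PauliString A) : PauliString C :=
  fun c => evolve hU (PauliString.tensor eAB p (PauliString.id B)) (eCD (Sum.inl c))

/-- The forward time-evolution map `Λ_D`: the `D`-part of the time-evolved Pauli
operator `U (p ⊗ I_B) U†`. -/
def forwardMapD (eAB : A ⊕ B ≃ S) (eCD : C ⊕ D ≃ S) {U : Op S} (hU : IsClifford U)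
    (p : PauliString A) : PauliString D :=
  fun d => evolve hU (PauliString.tensor eAB p (PauliString.id B)) (eCD (Sum.inr d))

/-- `U (p ⊗ I_B) U†` equals `Λ_C(p) ⊗ Λ_D(p)` up to phase. -/
theorem forwardMap_spec [Fintype A] [Fintype B] [Fintype C] [Fintype D]
    [DecidableEq A] [DecidableEq B] (eAB : A ⊕ B ≃ S) (eCD : C ⊕ D ≃ S) {U : Op S} (hU : IsClifford U) (p : PauliString A) :
    PhaseEq
      (Matrix.reindex (splitBits eCD) (splitBits eAB) U * (p.op ⊗ₖ (1 : Op B)) *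
        (Matrix.reindex (splitBits eCD) (splitBits eAB) U)ᴴ)
      ((forwardMapC eAB eCD hU p).op ⊗ₖ (forwardMapD eAB eCD hU p).op) := by
  obtain ⟨c, hc, h⟩ := evolve_spec hU (PauliString.tensor eAB p (PauliString.id B))
  refine ⟨c, hc, ?_⟩
  have h1 : PauliString.tensor eCD (forwardMapC eAB eCD hU p) (forwardMapD eAB eCD hU p)
      = evolve hU (PauliString.tensor eAB p (PauliString.id B)) := by
    funext s
    obtain ⟨t, rfl⟩ := eCD.surjective s
    rcases t with t | t <;> simp [PauliString.tensor, forwardMapC, forwardMapD]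
  rw [← PauliString.op_tensor eCD, h1, ← PauliString.op_id, ← PauliString.op_tensor eAB]
  have h2 := congrArg (Matrix.reindex (splitBits eCD) (splitBits eCD)) h
  refine Eq.trans ?_ (h2.trans rfl)
  simp [Matrix.reindex_apply, Matrix.submatrix_mul_equiv, Matrix.conjTranspose_submatrix]

end ForwardMap

/-- Amplitudes of `|EPR⟩ = 2^{-n/2} ∑_j |j⟩ ⊗ |j⟩` on two copies of the register `B`. -/
def epr (B : Type*) [Fintype B] [DecidableEq B] (x : Bits B × Bits B) : ℂ :=
  if x.1 = x.2 then ((1 / Real.sqrt (2 ^ Fintype.card B) : ℝ) : ℂ) else 0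

section HaydenPreskill

variable {S A B C D : Type*} [Fintype A] [Fintype B] [Fintype C] [Fintype D]
  [DecidableEq A] [DecidableEq B] [DecidableEq C] [DecidableEq D]

/-- The linear map `ψ ↦ ψ ⊗ |EPR⟩_{B B̄}` from `A` to `A B B̄`. -/
def attachEPR (A B : Type*) [Fintype A] [Fintype B] [DecidableEq A] [DecidableEq B] :
    Matrix ((Bits A × Bits B) × Bits B) (Bits A) ℂ :=
  Matrix.of fun x a => if x.1.1 = a then epr B (x.1.2, x.2) else 0

/-- The encoding isometry `Γ ψ = (U_{AB} ⊗ I_B̄) (ψ ⊗ |EPR⟩_{B B̄})` from `A` to `C D B̄`. -/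
def encoder (eAB : A ⊕ B ≃ S) (eCD : C ⊕ D ≃ S) (U : Op S) :
    Matrix ((Bits C × Bits D) × Bits B) (Bits A) ℂ :=
  (Matrix.reindex (splitBits eCD) (splitBits eAB) U ⊗ₖ (1 : Op B)) * attachEPR A B

/-- The noisy channel `N(σ) = Tr_C (Γ σ Γ†)` from `A` to `D B̄`. -/
def noisyChannel (eAB : A ⊕ B ≃ S) (eCD : C ⊕ D ≃ S) (U : Op S) (σ : Op A) :
    Matrix (Bits D × Bits B) (Bits D × Bits B) ℂ :=
  Matrix.of fun x y => ∑ c : Bits C,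
    (encoder eAB eCD U * σ * (encoder eAB eCD U)ᴴ) ((c, x.1), x.2) ((c, y.1), y.2)

end HaydenPreskill

/-- The map `id_k ⊗ Φ` on operators, written blockwise. -/
def ampliation {m n : Type*} (k : ℕ) (Φ : Matrix m m ℂ →ₗ[ℂ] Matrix n n ℂ)
    (M : Matrix (Fin k × m) (Fin k × m) ℂ) : Matrix (Fin k × n) (Fin k × n) ℂ :=
  Matrix.of fun x y => Φ (Matrix.of fun a b => M (x.1, a) (y.1, b)) x.2 y.2

/-- A quantum channel: a completely positive, trace-preserving linear map. -/
structure IsQuantumChannel {m n : Type*} [Fintype m] [Fintype n]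
    (Φ : Matrix m m ℂ →ₗ[ℂ] Matrix n n ℂ) : Prop where
  completelyPositive : ∀ (k : ℕ) (M : Matrix (Fin k × m) (Fin k × m) ℂ),
    M.PosSemidef → (ampliation k Φ M).PosSemidef
  tracePreserving : ∀ M : Matrix m m ℂ, (Φ M).trace = M.trace

/-- Density operators. -/
def IsState {m : Type*} [Fintype m] (σ : Matrix m m ℂ) : Prop :=
  σ.PosSemidef ∧ σ.trace = 1

/-- Perfect recovery in the Hayden-Preskill problem: one recovery channel from `D B̄` to `A`
restores every input state on `A`. -/
def PerfectRecovery {S A B C D : Type*} [Fintype A] [Fintype B] [Fintype C] [Fintype D]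
    [DecidableEq A] [DecidableEq B] [DecidableEq C] [DecidableEq D]
    (eAB : A ⊕ B ≃ S) (eCD : C ⊕ D ≃ S) (U : Op S) : Prop :=
  ∃ Rec : Matrix (Bits D × Bits B) (Bits D × Bits B) ℂ →ₗ[ℂ] Op A,
    IsQuantumChannel Rec ∧
      ∀ σ : Op A, IsState σ → Rec (noisyChannel eAB eCD U σ) = σ

end

/-!
The channel `N` has Kraus operators `K c = ⟨c|Γ`, one for each basis state `|c⟩` of `C`.

Pushing a Pauli operator `p` through the encoder gives `Γ p = (Λ_C(p) ⊗ Λ_D(p) ⊗ 1) Γ` up to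
phase, and the unitary `Λ_C(p)` disappears under the trace over `C`. Hence `N (p σ p†)` is the
conjugate of `N σ` by `Λ_D(p)`: if `Λ_D p = Λ_D q` with `p ≠ q`, then `N` cannot tell `p σ p†`
from `q σ q†`.

Conversely, let `r ≠ 1` be a Pauli operator on `C` and write `U† (r ⊗ 1) U = p ⊗ q` up to phase.
If `Λ_D` is injective then `q ≠ 1`, since otherwise `Λ_D p = 1 = Λ_D 1` would force `p = 1` and
`r = 1`. So `Γ† r Γ` is proportional to `Tr(q) p = 0`: the register `C` alone carries no
information about the input. Thus `(K c)† K c' = Γ† |c⟩⟨c'| Γ = δ_{cc'} / d_C`, and up to scale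
the `K c` are isometries with pairwise orthogonal ranges, which a recovery channel tells apart
and then inverts.
-/

section PhaseEq

theorem PhaseEq.refl {m n : Type*} (M : Matrix m n ℂ) : PhaseEq M M :=
  ⟨1, norm_one, (one_smul ℂ M).symm⟩

theorem PhaseEq.conjTranspose_mul_mul {m n : Type*} [Fintype m] [Fintype n] [DecidableEq n]
    {V : Matrix m n ℂ} (hV : Vᴴ * V = 1) {M : Matrix n n ℂ} {N : Matrix m m ℂ}
    (h : PhaseEq (V * M * Vᴴ) N) : PhaseEq (Vᴴ * N * V) M := by
  obtain ⟨c, hc, h⟩ := h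
  have hc0 : c ≠ 0 := norm_ne_zero_iff.1 (hc ▸ one_ne_zero)
  have hM : Vᴴ * (V * M * Vᴴ) * V = M := by
    rw [← Matrix.mul_assoc, ← Matrix.mul_assoc, hV, Matrix.one_mul, Matrix.mul_assoc, hV,
      Matrix.mul_one]
  refine ⟨c⁻¹, by rw [norm_inv, hc, inv_one], ?_⟩
  rw [eq_inv_smul_iff₀ hc0, ← Matrix.smul_mul, ← Matrix.mul_smul, ← h, hM]

theorem PhaseEq.mul_mul_conjTranspose {m n : Type*} [Fintype n] {M N : Matrix m n ℂ}
    (h : PhaseEq M N) (X : Matrix n n ℂ) : M * X * Mᴴ = N * X * Nᴴ := by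
  obtain ⟨c, hc, rfl⟩ := h
  have hcc : star c * c = 1 := by
    rw [Complex.star_def, Complex.conj_mul', hc, Complex.ofReal_one, one_pow]
  rw [Matrix.conjTranspose_smul, Matrix.mul_smul, Matrix.smul_mul, Matrix.smul_mul, smul_smul,
    hcc, one_smul]

theorem phaseEq_of_conj_eq {n : Type*} [Fintype n] [DecidableEq n] {u v : Matrix n n ℂ}
    (hu : u ∈ Matrix.unitaryGroup n ℂ) (hv : v ∈ Matrix.unitaryGroup n ℂ)
    (h : ∀ X, u * X * uᴴ = v * X * vᴴ) : PhaseEq u v := by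
  obtain ⟨α, hα⟩ := (Unitary.conjStarAlgAut_ext_iff' (S := ℂ) ⟨u, hu⟩ ⟨v, hv⟩).1
    (StarAlgEquiv.ext h)
  exact ⟨α, CStarRing.norm_coe_unitary α, congrArg Subtype.val hα⟩

end PhaseEq

section PauliOperators

theorem Pauli.mat_I : Pauli.I.mat = 1 := by
  ext i j
  fin_cases i <;> fin_cases j <;> simp [Pauli.mat]

theorem Pauli.mat_mul_self (a : Pauli) : a.mat * a.mat = 1 := by
  ext i j
  cases a <;> fin_cases i <;> fin_cases j <;> simp [Pauli.mat, Matrix.mul_apply]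

theorem Pauli.star_mat_apply (a : Pauli) (i j : Fin 2) : star (a.mat i j) = a.mat j i := by
  cases a <;> fin_cases i <;> fin_cases j <;> simp [Pauli.mat]

theorem Pauli.trace_mat_of_ne {a : Pauli} (h : a ≠ Pauli.I) : a.mat.trace = 0 := by
  cases a <;> first | exact absurd rfl h | simp [Pauli.mat, Matrix.trace_fin_two]

instance : Fintype Pauli where
  elems := ⟨[Pauli.I, Pauli.X, Pauli.Y, Pauli.Z], by simp⟩
  complete a := by cases a <;> simp

theorem Pauli.sum_univ {M : Type*} [AddCommMonoid M] (f : Pauli → M) :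
    ∑ a, f a = f Pauli.I + (f Pauli.X + (f Pauli.Y + f Pauli.Z)) := by
  simp [Finset.univ, Fintype.elems, Finset.sum]

theorem Pauli.sum_mat_mul_mat (i j k l : Fin 2) :
    ∑ a : Pauli, a.mat i j * a.mat k l = if i = l ∧ j = k then 2 else 0 := by
  rw [Pauli.sum_univ]
  fin_cases i <;> fin_cases j <;> fin_cases k <;> fin_cases l <;> simp [Pauli.mat] <;> norm_num

variable {S : Type*} [Fintype S]

theorem PauliString.conjTranspose_op (p : PauliString S) : p.opᴴ = p.op := by
  ext x y
  simp only [PauliString.op, Matrix.conjTranspose_apply, Matrix.of_apply, star_prod,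
    Pauli.star_mat_apply]

variable [DecidableEq S]

theorem PauliString.op_mul_self (p : PauliString S) : p.op * p.op = 1 := by
  rw [← PauliString.op_id]
  ext x y
  simp only [Matrix.mul_apply, PauliString.op, Matrix.of_apply, ← Finset.prod_mul_distrib]
  rw [← Fintype.prod_sum fun s i => (p s).mat (x s) i * (p s).mat i (y s)]
  refine Finset.prod_congr rfl fun s _ => ?_
  rw [← Matrix.mul_apply, Pauli.mat_mul_self, PauliString.id, Pauli.mat_I]

theorem PauliString.op_mem_unitaryGroup (p : PauliString S) :
    p.op ∈ Matrix.unitaryGroup (Bits S) ℂ :=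
  Matrix.mem_unitaryGroup_iff.2 <| by
    rw [Matrix.star_eq_conjTranspose, p.conjTranspose_op, p.op_mul_self]

theorem PauliString.trace_op_of_ne {p : PauliString S} (h : p ≠ PauliString.id S) :
    p.op.trace = 0 := by
  have hprod : p.op.trace = ∏ s, (p s).mat.trace := by
    simp only [Matrix.trace, Matrix.diag, PauliString.op, Matrix.of_apply, Fintype.prod_sum]
  obtain ⟨s, hs⟩ := Function.ne_iff.1 h
  rw [hprod]
  exact Finset.prod_eq_zero (Finset.mem_univ s) (Pauli.trace_mat_of_ne hs)

theorem PauliString.sum_op_mul_op (x y z w : Bits S) :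
    ∑ p : PauliString S, p.op x y * p.op z w =
      if x = w ∧ y = z then (2 : ℂ) ^ Fintype.card S else 0 := by
  simp only [PauliString.op, Matrix.of_apply, ← Finset.prod_mul_distrib]
  rw [← Fintype.prod_sum fun s (a : Pauli) => a.mat (x s) (y s) * a.mat (z s) (w s)]
  simp only [Pauli.sum_mat_mul_mat, Finset.prod_ite_zero, Finset.mem_univ, forall_const,
    forall_and, funext_iff, Finset.prod_const, Finset.card_univ]

omit [DecidableEq S] in
theorem PauliString.span_range_op :
    Submodule.span ℂ (Set.range (PauliString.op : PauliString S → Op S)) = ⊤ := by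
  classical
  have hsingle (x y : Bits S) : Matrix.single x y (1 : ℂ) =
      ((2 : ℂ) ^ Fintype.card S)⁻¹ • ∑ p : PauliString S, p.op y x • p.op := by
    ext z w
    simp [Matrix.sum_apply, PauliString.sum_op_mul_op, Matrix.single_apply, and_comm, ite_and]
  refine eq_top_iff.2 fun M _ => ?_
  rw [Matrix.matrix_eq_sum_single M]
  refine Submodule.sum_mem _ fun x _ => Submodule.sum_mem _ fun y _ => ?_
  rw [← mul_one (M x y), ← smul_eq_mul, ← Matrix.smul_single, hsingle]
  exact Submodule.smul_mem _ _ <| Submodule.smul_mem _ _ <| Submodule.sum_mem _ fun p _ =>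
    Submodule.smul_mem _ _ <| Submodule.subset_span ⟨p, rfl⟩

theorem PauliString.eq_of_conj_eq {p q : PauliString S}
    (h : ∀ X : Op S, p.op * X * p.op = q.op * X * q.op) : p = q :=
  PauliString.eq_of_phaseEq (PhaseEq.refl p.op) <|
    phaseEq_of_conj_eq p.op_mem_unitaryGroup q.op_mem_unitaryGroup <| by
      simpa only [PauliString.conjTranspose_op] using h

end PauliOperators

section PauliTensor

variable {K L S : Type*} (e : K ⊕ L ≃ S)

theorem PauliString.tensor_apply_inl (p : PauliString K) (q : PauliString L) (k : K) :
    PauliString.tensor e p q (e (Sum.inl k)) = p k := by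
  simp [PauliString.tensor]

theorem PauliString.tensor_apply_inr (p : PauliString K) (q : PauliString L) (l : L) :
    PauliString.tensor e p q (e (Sum.inr l)) = q l := by
  simp [PauliString.tensor]

theorem PauliString.tensor_comp_inl_comp_inr (r : PauliString S) :
    PauliString.tensor e (r ∘ e ∘ Sum.inl) (r ∘ e ∘ Sum.inr) = r := by
  funext s
  obtain ⟨k | l, rfl⟩ := e.surjective s
  · exact PauliString.tensor_apply_inl e _ _ k
  · exact PauliString.tensor_apply_inr e _ _ l

theorem PauliString.tensor_id_id :
    PauliString.tensor e (PauliString.id K) (PauliString.id L) = PauliString.id S :=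
  PauliString.tensor_comp_inl_comp_inr e (PauliString.id S)

end PauliTensor

section Clifford

variable {S : Type*} [Fintype S] [DecidableEq S] {U : Op S} (hU : IsClifford U)

theorem evolve_id : evolve hU (PauliString.id S) = PauliString.id S := by
  have hUU : U * Uᴴ = 1 := Matrix.mem_unitaryGroup_iff.1 hU.1
  refine PauliString.eq_of_phaseEq (evolve_spec hU _) ?_
  rw [PauliString.op_id, mul_one, hUU]
  exact PhaseEq.refl 1

theorem evolve_surjective : Function.Surjective (evolve hU) := by
  have hback (p : PauliString S) : PhaseEq (Uᴴ * (evolve hU p).op * U) p.op :=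
    (evolve_spec hU p).conjTranspose_mul_mul (Matrix.mem_unitaryGroup_iff'.1 hU.1)
  refine Finite.surjective_of_injective fun p q hpq => ?_
  exact PauliString.eq_of_phaseEq (hback p) (hpq ▸ hback q)

variable {A B C D : Type*} (eAB : A ⊕ B ≃ S) (eCD : C ⊕ D ≃ S)

theorem forwardMapD_id : forwardMapD eAB eCD hU (PauliString.id A) = PauliString.id D := by
  funext d
  rw [forwardMapD, PauliString.tensor_id_id, evolve_id, PauliString.id, PauliString.id]

theorem exists_evolve_tensor_eq_of_injective
    (hinj : Function.Injective (forwardMapD eAB eCD hU)) {r : PauliString C}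
    (hr : r ≠ PauliString.id C) :
    ∃ (p : PauliString A) (q : PauliString B), q ≠ PauliString.id B ∧
      evolve hU (PauliString.tensor eAB p q) = PauliString.tensor eCD r (PauliString.id D) := by
  obtain ⟨t, ht⟩ := evolve_surjective hU (PauliString.tensor eCD r (PauliString.id D))
  refine ⟨t ∘ eAB ∘ Sum.inl, t ∘ eAB ∘ Sum.inr, fun hq => hr ?_, ?_⟩
  · rw [← PauliString.tensor_comp_inl_comp_inr eAB t, hq] at ht
    have hp : t ∘ eAB ∘ Sum.inl = PauliString.id A := by
      refine hinj (Eq.trans (funext fun d => ?_) (forwardMapD_id hU eAB eCD).symm)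
      rw [forwardMapD, ht, PauliString.tensor_apply_inr]
    rw [hp, PauliString.tensor_id_id, evolve_id] at ht
    funext c
    rw [← PauliString.tensor_apply_inl eCD r (PauliString.id D) c, ← ht]
    rfl
  · rw [PauliString.tensor_comp_inl_comp_inr, ht]

end Clifford

section Channels

variable {m n ι κ : Type*} [Fintype m] [Fintype ι]

/-- The completely positive map with Kraus operators `K i`. -/
noncomputable def krausMap (K : ι → Matrix n m ℂ) : Matrix m m ℂ →ₗ[ℂ] Matrix n n ℂ where
  toFun X := ∑ i, K i * X * (K i)ᴴ
  map_add' X Y := by simp only [Matrix.mul_add, Matrix.add_mul, Finset.sum_add_distrib]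
  map_smul' c X := by
    simp only [Matrix.mul_smul, Matrix.smul_mul, Finset.smul_sum, RingHom.id_apply]

theorem krausMap_apply (K : ι → Matrix n m ℂ) (X : Matrix m m ℂ) :
    krausMap K X = ∑ i, K i * X * (K i)ᴴ := rfl

theorem krausMap_mul_left {k : Type*} [Fintype n] (F : Matrix k n ℂ) (K : ι → Matrix n m ℂ)
    (X : Matrix m m ℂ) : krausMap (fun i => F * K i) X = F * krausMap K X * Fᴴ := by
  simp only [krausMap_apply, Matrix.mul_sum, Matrix.sum_mul, Matrix.conjTranspose_mul,
    Matrix.mul_assoc]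

theorem krausMap_mul_right {k : Type*} [Fintype k] (K : ι → Matrix n m ℂ) (G : Matrix m k ℂ)
    (X : Matrix k k ℂ) : krausMap (fun i => K i * G) X = krausMap K (G * X * Gᴴ) := by
  simp only [krausMap_apply, Matrix.conjTranspose_mul, Matrix.mul_assoc]

theorem krausMap_congr_phaseEq {K L : ι → Matrix n m ℂ} (h : ∀ i, PhaseEq (K i) (L i)) :
    krausMap K = krausMap L :=
  LinearMap.ext fun X => Finset.sum_congr rfl fun i _ => (h i).mul_mul_conjTranspose X

theorem krausMap_sum_smul_of_isometry [Fintype κ] [DecidableEq ι] {W : Matrix κ ι ℂ}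
    (hW : Wᴴ * W = 1) (K : ι → Matrix n m ℂ) :
    krausMap (fun k => ∑ i, W k i • K i) = krausMap K := by
  have hW' (j i : ι) : ∑ k, star (W k j) * W k i = if j = i then 1 else 0 := by
    simpa only [Matrix.mul_apply, Matrix.conjTranspose_apply, Matrix.one_apply]
      using congrFun (congrFun hW j) i
  ext1 X
  calc krausMap (fun k => ∑ i, W k i • K i) X
      = ∑ k, ∑ j, ∑ i, (star (W k j) * W k i) • (K i * X * (K j)ᴴ) := by
        simp only [krausMap_apply, Matrix.conjTranspose_sum, Matrix.conjTranspose_smul,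
          Matrix.mul_sum, Matrix.sum_mul, Matrix.smul_mul, Matrix.mul_smul, Finset.smul_sum,
          smul_smul]
    _ = ∑ j, ∑ i, (∑ k, star (W k j) * W k i) • (K i * X * (K j)ᴴ) := by
        simp only [Finset.sum_smul]
        rw [Finset.sum_comm]
        exact Finset.sum_congr rfl fun j _ => Finset.sum_comm
    _ = krausMap K X := by
        simp only [hW', ite_smul, one_smul, zero_smul, Finset.sum_ite_eq, Finset.mem_univ,
          if_true, krausMap_apply]

theorem ampliation_krausMap (k : ℕ) (K : ι → Matrix n m ℂ)
    (M : Matrix (Fin k × m) (Fin k × m) ℂ) :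
    ampliation k (krausMap K) M =
      krausMap (fun i => (1 : Matrix (Fin k) (Fin k) ℂ) ⊗ₖ K i) M := by
  ext ⟨a, x⟩ ⟨b, y⟩
  simp [ampliation, krausMap_apply, Matrix.sum_apply, Matrix.mul_apply, Fintype.sum_prod_type,
    Matrix.one_apply, apply_ite, ite_mul, Finset.sum_ite_irrel]

theorem isQuantumChannel_krausMap [Fintype n] [DecidableEq m] {K : ι → Matrix n m ℂ}
    (hK : ∑ i, (K i)ᴴ * K i = 1) : IsQuantumChannel (krausMap K) where
  completelyPositive k M hM := by
    rw [ampliation_krausMap, krausMap_apply]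
    exact Matrix.posSemidef_sum _ fun i _ => hM.mul_mul_conjTranspose_same _
  tracePreserving M := by
    simp only [krausMap_apply, Matrix.trace_sum, Matrix.trace_mul_comm _ (_ᴴ),
      ← Matrix.mul_assoc]
    rw [← Matrix.trace_sum, ← Matrix.sum_mul, hK, Matrix.one_mul]

theorem sum_conjTranspose_single_mul_mul_single_mul {k : Type*} [Fintype n] [DecidableEq n]
    [DecidableEq m] (a : n) (M : Matrix m k ℂ) :
    ∑ x : m, (Matrix.single a x (1 : ℂ) * M)ᴴ * (Matrix.single a x (1 : ℂ) * M) = Mᴴ * M := by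
  have hterm (x : m) : (Matrix.single a x (1 : ℂ) * M)ᴴ * (Matrix.single a x (1 : ℂ) * M) =
      Mᴴ * (Matrix.single x x (1 : ℂ) * M) := by
    rw [Matrix.conjTranspose_mul, Matrix.conjTranspose_single, star_one, Matrix.mul_assoc,
      ← Matrix.mul_assoc (Matrix.single x a _), Matrix.single_mul_single_same, mul_one]
  simp only [hterm]
  rw [← Matrix.mul_sum, ← Matrix.sum_mul, Matrix.sum_single_one, Matrix.one_mul]

end Channels

section OrthogonalIsometries

variable {m n ι : Type*} [Fintype m] [DecidableEq n] [DecidableEq ι]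

/-- A family of isometries with pairwise orthogonal ranges: they embed copies of one system into
another so that the copies can be told apart by a measurement. -/
def OrthogonalIsometries (V : ι → Matrix m n ℂ) : Prop :=
  ∀ i j, (V i)ᴴ * V j = if i = j then 1 else 0

namespace OrthogonalIsometries

variable [Fintype n] {V : ι → Matrix m n ℂ} (hV : OrthogonalIsometries V)
include hV

theorem sum_mul_conjTranspose_mul [Fintype ι] (j : ι) : (∑ i, V i * (V i)ᴴ) * V j = V j := by
  have hterm (i : ι) : V i * (V i)ᴴ * V j = if i = j then V j else 0 := by
    rw [Matrix.mul_assoc, hV]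
    split_ifs with h <;> simp [h]
  simp only [Matrix.sum_mul, hterm, Finset.sum_ite_eq', Finset.mem_univ, if_true]

theorem isStarProjection_sum_mul_conjTranspose [Fintype ι] :
    IsStarProjection (∑ i, V i * (V i)ᴴ) where
  isIdempotentElem := by
    rw [IsIdempotentElem, Matrix.mul_sum]
    simp only [← Matrix.mul_assoc, hV.sum_mul_conjTranspose_mul]
  isSelfAdjoint := by
    simp only [IsSelfAdjoint, Matrix.star_eq_conjTranspose, Matrix.conjTranspose_sum,
      Matrix.conjTranspose_mul, Matrix.conjTranspose_conjTranspose]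

theorem exists_isQuantumChannel_leftInverse [Finite ι] [Nonempty n] :
    ∃ R : Matrix m m ℂ →ₗ[ℂ] Matrix n n ℂ, IsQuantumChannel R ∧
      ∀ i σ, R (V i * σ * (V i)ᴴ) = σ := by
  classical
  cases nonempty_fintype ι
  obtain ⟨a⟩ := ‹Nonempty n›
  obtain ⟨Q, hQ⟩ : ∃ Q : Matrix m m ℂ, Q = 1 - ∑ i, V i * (V i)ᴴ := ⟨_, rfl⟩
  have hQQ : Qᴴ * Q = Q := by
    have hQproj : IsStarProjection Q :=
      hQ ▸ hV.isStarProjection_sum_mul_conjTranspose.one_sub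
    rw [← Matrix.star_eq_conjTranspose, hQproj.isSelfAdjoint.star_eq, hQproj.isIdempotentElem.eq]
  have hQV (i : ι) : Q * V i = 0 := by
    rw [hQ, Matrix.sub_mul, Matrix.one_mul, hV.sum_mul_conjTranspose_mul, sub_self]
  -- On the range of `V i` undo `V i`; on the orthogonal complement of all ranges reset to `|a⟩`.
  let L : ι ⊕ m → Matrix n m ℂ :=
    Sum.elim (fun i => (V i)ᴴ) (fun x => Matrix.single a x (1 : ℂ) * Q)
  refine ⟨krausMap L, isQuantumChannel_krausMap ?_, fun i σ => ?_⟩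
  · rw [Fintype.sum_sum_type]
    simp only [L, Sum.elim_inl, Sum.elim_inr, Matrix.conjTranspose_conjTranspose,
      sum_conjTranspose_single_mul_mul_single_mul, hQQ]
    rw [hQ, add_sub_cancel]
  · have hinr (x : m) : L (Sum.inr x) * V i = 0 := by
      simp only [L, Sum.elim_inr, Matrix.mul_assoc, hQV, Matrix.mul_zero]
    rw [← krausMap_mul_right, krausMap_apply, Fintype.sum_sum_type]
    simp only [hinr]
    simp [L, hV _ i]

end OrthogonalIsometries

end OrthogonalIsometries

theorem exists_isQuantumChannel_krausMap_leftInverse {m n ι : Type*} [Fintype m] [Fintype n]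
    [Fintype ι] [DecidableEq n] [DecidableEq ι] [Nonempty n]
    {K : ι → Matrix m n ℂ} {w : ι → ℝ} (hw : ∀ i, 0 < w i) (hw1 : ∑ i, w i = 1)
    (hK : ∀ i j, (K i)ᴴ * K j = if i = j then (w i : ℂ) • 1 else 0) :
    ∃ R : Matrix m m ℂ →ₗ[ℂ] Matrix n n ℂ, IsQuantumChannel R ∧ ∀ σ, R (krausMap K σ) = σ := by
  have hw0 (i : ι) : (w i : ℂ) ≠ 0 := Complex.ofReal_ne_zero.2 (hw i).ne'
  obtain ⟨s, hs_star, hs_sq⟩ : ∃ s : ι → ℂ, (∀ i, star (s i) = s i) ∧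
      ∀ i, s i * s i = (w i : ℂ)⁻¹ := by
    refine ⟨fun i => (√(w i)⁻¹ : ℝ), fun i => Complex.conj_ofReal _, fun i => ?_⟩
    rw [← Complex.ofReal_mul, Real.mul_self_sqrt (inv_nonneg.2 (hw i).le), Complex.ofReal_inv]
  have hV : OrthogonalIsometries fun i => s i • K i := by
    intro i j
    rw [Matrix.conjTranspose_smul, Matrix.smul_mul, Matrix.mul_smul, smul_smul, hs_star, hK]
    obtain rfl | hij := eq_or_ne i j
    · rw [if_pos rfl, if_pos rfl, smul_smul, hs_sq, inv_mul_cancel₀ (hw0 i), one_smul]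
    · rw [if_neg hij, if_neg hij, smul_zero]
  obtain ⟨R, hR, hRV⟩ := hV.exists_isQuantumChannel_leftInverse
  have hterm (i : ι) (σ : Matrix n n ℂ) : R (K i * σ * (K i)ᴴ) = (w i : ℂ) • σ := by
    have h := hRV i σ
    rw [Matrix.conjTranspose_smul, Matrix.smul_mul, Matrix.smul_mul, Matrix.mul_smul, smul_smul,
      hs_star, hs_sq, map_smul] at h
    exact (inv_smul_eq_iff₀ (hw0 i)).1 h
  refine ⟨R, hR, fun σ => ?_⟩
  rw [krausMap_apply, map_sum, Finset.sum_congr rfl fun i _ => hterm i σ, ← Finset.sum_smul,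
    ← Complex.ofReal_sum, hw1, Complex.ofReal_one, one_smul]

section States

variable {m : Type*} [Fintype m]

open scoped MatrixOrder Matrix.Norms.L2Operator in
theorem span_setOf_isState : Submodule.span ℂ {σ : Matrix m m ℂ | IsState σ} = ⊤ := by
  classical
  rw [eq_top_iff, ← CStarAlgebra.span_nonneg, Submodule.span_le]
  intro M hM
  have hM : M.PosSemidef := Matrix.nonneg_iff_posSemidef.1 hM
  by_cases ht : M.trace = 0
  · rw [hM.trace_eq_zero_iff.1 ht]
    exact zero_mem _
  · rw [← smul_inv_smul₀ ht M]
    exact Submodule.smul_mem _ _ <| Submodule.subset_span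
      ⟨hM.smul (inv_nonneg.2 hM.trace_nonneg), by simp [ht]⟩

theorem IsState.conj_of_mem_unitaryGroup [DecidableEq m] {σ u : Matrix m m ℂ} (hσ : IsState σ)
    (hu : u ∈ Matrix.unitaryGroup m ℂ) : IsState (u * σ * uᴴ) := by
  have huu : uᴴ * u = 1 := Matrix.mem_unitaryGroup_iff'.1 hu
  refine ⟨hσ.1.mul_mul_conjTranspose_same u, ?_⟩
  rw [Matrix.trace_mul_comm, ← mul_assoc, huu, one_mul, hσ.2]

end States

section Registers

theorem reindex_mul_mul_conjTranspose {m n k l : Type*} [Fintype n] [Fintype l] (e : m ≃ k)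
    (f : n ≃ l) (U : Matrix m n ℂ) (M : Matrix n n ℂ) :
    Matrix.reindex e f U * Matrix.reindex f f M * (Matrix.reindex e f U)ᴴ =
      Matrix.reindex e e (U * M * Uᴴ) := by
  simp only [Matrix.reindex_apply, Matrix.conjTranspose_submatrix, Matrix.submatrix_mul_equiv]

theorem conjTranspose_reindex_mul_reindex {m n k l : Type*} [Fintype m] [Fintype k]
    [DecidableEq n] [DecidableEq l] (e : m ≃ k) (f : n ≃ l) {U : Matrix m n ℂ}
    (hU : Uᴴ * U = 1) : (Matrix.reindex e f U)ᴴ * Matrix.reindex e f U = 1 := by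
  simp only [Matrix.reindex_apply, Matrix.conjTranspose_submatrix, Matrix.submatrix_mul_equiv,
    hU, Matrix.submatrix_one_equiv]

theorem phaseEq_reindex_conj_of_evolve_tensor {S A B C D : Type*} [Fintype S] [DecidableEq S]
    [Fintype A] [Fintype B] [Fintype C] [Fintype D] [DecidableEq A] [DecidableEq B]
    {eAB : A ⊕ B ≃ S} {eCD : C ⊕ D ≃ S} {U : Op S} (hU : IsClifford U) {p : PauliString A}
    {q : PauliString B} {r : PauliString C} {t : PauliString D}
    (h : evolve hU (PauliString.tensor eAB p q) = PauliString.tensor eCD r t) :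
    PhaseEq
      (Matrix.reindex (splitBits eCD) (splitBits eAB) U * (p.op ⊗ₖ q.op) *
        (Matrix.reindex (splitBits eCD) (splitBits eAB) U)ᴴ)
      (r.op ⊗ₖ t.op) := by
  obtain ⟨c, hc, hevolve⟩ := evolve_spec hU (PauliString.tensor eAB p q)
  refine ⟨c, hc, ?_⟩
  rw [← PauliString.op_tensor eAB, ← PauliString.op_tensor eCD, reindex_mul_mul_conjTranspose,
    hevolve, h]
  rfl

variable {α γ δ β : Type*}

/-- The block `(⟨c| ⊗ I ⊗ I) G` of an operator `G` into a three-part system. Ranging over the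
basis labels `c`, these are Kraus operators for applying `G` and then tracing out the first part. -/
def partialBra (c : γ) (G : Matrix ((γ × δ) × β) α ℂ) : Matrix (δ × β) α ℂ :=
  G.submatrix (fun x => ((c, x.1), x.2)) id

theorem partialBra_mul [Fintype α] {α' : Type*} (c : γ) (G : Matrix ((γ × δ) × β) α ℂ)
    (M : Matrix α α' ℂ) : partialBra c (G * M) = partialBra c G * M := rfl

variable [Fintype γ] [Fintype δ] [Fintype β] [DecidableEq β]

theorem partialBra_kronecker_mul (c : γ) (E : Matrix γ γ ℂ) (L : Matrix δ δ ℂ)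
    (G : Matrix ((γ × δ) × β) α ℂ) :
    partialBra c (((E ⊗ₖ L) ⊗ₖ (1 : Matrix β β ℂ)) * G) =
      ∑ c', E c c' • ((L ⊗ₖ (1 : Matrix β β ℂ)) * partialBra c' G) := by
  ext ⟨d, b⟩ a
  simp [partialBra, Matrix.mul_apply, Matrix.sum_apply, Fintype.sum_prod_type, Matrix.one_apply,
    Finset.mul_sum, mul_assoc]

theorem conjTranspose_partialBra_mul_partialBra [DecidableEq γ] [DecidableEq δ] (c c' : γ)
    (G : Matrix ((γ × δ) × β) α ℂ) : (partialBra c G)ᴴ * partialBra c' G =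
      Gᴴ * ((Matrix.single c c' (1 : ℂ) ⊗ₖ (1 : Matrix δ δ ℂ)) ⊗ₖ (1 : Matrix β β ℂ)) * G := by
  ext a a'
  simp [partialBra, Matrix.mul_apply, Fintype.sum_prod_type, Matrix.one_apply,
    Matrix.single_apply, ite_and]

end Registers

section Encoder

theorem sum_star_epr_mul_epr {B : Type*} [Fintype B] [DecidableEq B] (b b' : Bits B) :
    ∑ x, star (epr B (b, x)) * epr B (b', x) =
      if b = b' then ((2 : ℂ) ^ Fintype.card B)⁻¹ else 0 := by
  have hsqrt : ((1 / √(2 ^ Fintype.card B) : ℝ) : ℂ) * ((1 / √(2 ^ Fintype.card B) : ℝ) : ℂ) =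
      ((2 : ℂ) ^ Fintype.card B)⁻¹ := by
    rw [← Complex.ofReal_mul, one_div, ← mul_inv, Real.mul_self_sqrt (by positivity)]
    push_cast
    rfl
  simp only [epr, apply_ite star, star_zero, Complex.star_def, Complex.conj_ofReal, ite_mul,
    zero_mul, Finset.sum_ite_eq, Finset.mem_univ, if_true, mul_ite, mul_zero, hsqrt]

variable {S A B C D : Type*} [Fintype A] [Fintype B] [DecidableEq A] [DecidableEq B]

theorem attachEPR_mul (M : Op A) :
    attachEPR A B * M = ((M ⊗ₖ (1 : Op B)) ⊗ₖ (1 : Op B)) * attachEPR A B := by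
  ext ⟨⟨a, b⟩, b'⟩ a'
  simp [attachEPR, Matrix.mul_apply, Fintype.sum_prod_type, Matrix.one_apply, mul_comm]

theorem conjTranspose_attachEPR_mul_mul_attachEPR (M : Op A) (N : Op B) :
    (attachEPR A B)ᴴ * ((M ⊗ₖ N) ⊗ₖ (1 : Op B)) * attachEPR A B =
      (((2 : ℂ) ^ Fintype.card B)⁻¹ * N.trace) • M := by
  ext a a'
  calc ((attachEPR A B)ᴴ * ((M ⊗ₖ N) ⊗ₖ (1 : Op B)) * attachEPR A B) a a'
      = ∑ b', ∑ x, ∑ b, star (epr B (b, x)) * (M a a' * N b b') * epr B (b', x) := by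
        simp [attachEPR, Matrix.mul_apply, Fintype.sum_prod_type, Matrix.one_apply, apply_ite,
          Finset.sum_mul]
    _ = ∑ b', ∑ b, M a a' * N b b' * ∑ x, star (epr B (b, x)) * epr B (b', x) := by
        refine Finset.sum_congr rfl fun b' _ => ?_
        rw [Finset.sum_comm]
        simp only [Finset.mul_sum, mul_assoc, mul_left_comm (star _)]
    _ = ((((2 : ℂ) ^ Fintype.card B)⁻¹ * N.trace) • M) a a' := by
        simp only [sum_star_epr_mul_epr, mul_ite, mul_zero, Finset.sum_ite_eq', Finset.mem_univ,
          if_true, Matrix.smul_apply, smul_eq_mul, Matrix.trace, Matrix.diag, Finset.mul_sum,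
          Finset.sum_mul]
        exact Finset.sum_congr rfl fun _ _ => by ring

variable [Fintype C] [DecidableEq C] (eAB : A ⊕ B ≃ S) (eCD : C ⊕ D ≃ S)

theorem noisyChannel_eq_krausMap (U : Op S) (σ : Op A) :
    noisyChannel eAB eCD U σ = krausMap (fun c => partialBra c (encoder eAB eCD U)) σ := by
  ext x y
  simp [noisyChannel, partialBra, krausMap_apply, Matrix.sum_apply, Matrix.mul_apply]

variable [Fintype D] [DecidableEq D]

theorem conjTranspose_encoder_mul_mul_encoder (U : Op S)
    (M : Matrix (Bits C × Bits D) (Bits C × Bits D) ℂ) :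
    (encoder eAB eCD U)ᴴ * (M ⊗ₖ (1 : Op B)) * encoder eAB eCD U =
      (attachEPR A B)ᴴ * (((Matrix.reindex (splitBits eCD) (splitBits eAB) U)ᴴ * M *
        Matrix.reindex (splitBits eCD) (splitBits eAB) U) ⊗ₖ (1 : Op B)) * attachEPR A B := by
  have hsplit (V : Matrix (Bits C × Bits D) (Bits A × Bits B) ℂ) :
      (Vᴴ * M * V) ⊗ₖ (1 : Op B) = (Vᴴ ⊗ₖ (1 : Op B)) * (M ⊗ₖ (1 : Op B)) * (V ⊗ₖ (1 : Op B)) := by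
    rw [← Matrix.mul_kronecker_mul, ← Matrix.mul_kronecker_mul, Matrix.one_mul, Matrix.one_mul]
  rw [hsplit]
  simp only [encoder, Matrix.conjTranspose_mul, Matrix.conjTranspose_kronecker,
    Matrix.conjTranspose_one, Matrix.mul_assoc]

variable [Fintype S] [DecidableEq S]

theorem encoder_mul {U : Op S} (hU : U ∈ Matrix.unitaryGroup (Bits S) ℂ) (M : Op A) :
    encoder eAB eCD U * M =
      ((Matrix.reindex (splitBits eCD) (splitBits eAB) U * (M ⊗ₖ (1 : Op B)) *
        (Matrix.reindex (splitBits eCD) (splitBits eAB) U)ᴴ) ⊗ₖ (1 : Op B)) *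
          encoder eAB eCD U := by
  have hV := conjTranspose_reindex_mul_reindex (splitBits eCD) (splitBits eAB)
    (Matrix.mem_unitaryGroup_iff'.1 hU)
  rw [encoder, Matrix.mul_assoc, attachEPR_mul, ← Matrix.mul_assoc, ← Matrix.mul_assoc,
    ← Matrix.mul_kronecker_mul, ← Matrix.mul_kronecker_mul, Matrix.mul_assoc _ _ᴴ, hV,
    Matrix.mul_one, Matrix.mul_one]

theorem encoder_mul_op {U : Op S} (hU : IsClifford U) (p : PauliString A) :
    PhaseEq (encoder eAB eCD U * p.op)
      ((((forwardMapC eAB eCD hU p).op ⊗ₖ (forwardMapD eAB eCD hU p).op) ⊗ₖ (1 : Op B)) *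
        encoder eAB eCD U) := by
  obtain ⟨c, hc, h⟩ := forwardMap_spec eAB eCD hU p
  refine ⟨c, hc, ?_⟩
  rw [encoder_mul eAB eCD hU.1, h, Matrix.smul_kronecker, Matrix.smul_mul]

theorem noisyChannel_op_conj {U : Op S} (hU : IsClifford U) (p : PauliString A) (σ : Op A) :
    noisyChannel eAB eCD U (p.op * σ * p.op) =
      ((forwardMapD eAB eCD hU p).op ⊗ₖ (1 : Op B)) * noisyChannel eAB eCD U σ *
        ((forwardMapD eAB eCD hU p).op ⊗ₖ (1 : Op B))ᴴ := by
  let K (c : Bits C) := partialBra c (encoder eAB eCD U)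
  let F := (forwardMapD eAB eCD hU p).op ⊗ₖ (1 : Op B)
  have hKp (c : Bits C) :
      PhaseEq (K c * p.op) (∑ c', (forwardMapC eAB eCD hU p).op c c' • (F * K c')) := by
    obtain ⟨φ, hφ, h⟩ := encoder_mul_op eAB eCD hU p
    refine ⟨φ, hφ, ?_⟩
    rw [← partialBra_kronecker_mul, ← partialBra_mul, h]
    rfl
  have hC : ((forwardMapC eAB eCD hU p).op)ᴴ * (forwardMapC eAB eCD hU p).op = 1 :=
    Matrix.mem_unitaryGroup_iff'.1 (PauliString.op_mem_unitaryGroup _)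
  calc noisyChannel eAB eCD U (p.op * σ * p.op)
      = krausMap (fun c => K c * p.op) σ := by
        rw [krausMap_mul_right, p.conjTranspose_op, noisyChannel_eq_krausMap]
    _ = krausMap (fun c' => F * K c') σ := by
        rw [krausMap_congr_phaseEq hKp, krausMap_sum_smul_of_isometry hC]
    _ = F * noisyChannel eAB eCD U σ * Fᴴ := by
        rw [krausMap_mul_left, noisyChannel_eq_krausMap]

end Encoder

section Distinguishability

variable {S A B C D : Type*} [Fintype A] [Fintype B] [Fintype C] [DecidableEq A] [DecidableEq B]
  [DecidableEq C] {eAB : A ⊕ B ≃ S} {eCD : C ⊕ D ≃ S} {U : Op S}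

theorem PerfectRecovery.injOn_noisyChannel [Fintype D] [DecidableEq D]
    (h : PerfectRecovery eAB eCD U) : Set.InjOn (noisyChannel eAB eCD U) {σ | IsState σ} := by
  obtain ⟨R, -, hR⟩ := h
  exact fun σ hσ τ hτ hστ => by rw [← hR σ hσ, ← hR τ hτ, hστ]

theorem forwardMapD_injective_of_injOn_noisyChannel [Fintype S] [DecidableEq S] [Finite D]
    (hU : IsClifford U)
    (h : Set.InjOn (noisyChannel eAB eCD U) {σ | IsState σ}) :
    Function.Injective (forwardMapD eAB eCD hU) := by
  classical
  cases nonempty_fintype D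
  intro p q hpq
  have hstate (r : PauliString A) {σ : Op A} (hσ : IsState σ) : IsState (r.op * σ * r.op) := by
    simpa only [r.conjTranspose_op] using hσ.conj_of_mem_unitaryGroup r.op_mem_unitaryGroup
  let conj (r : PauliString A) : Op A →ₗ[ℂ] Op A :=
    LinearMap.mulRight ℂ r.op ∘ₗ LinearMap.mulLeft ℂ r.op
  have hconj : conj p = conj q := by
    refine LinearMap.ext_on span_setOf_isState fun σ hσ => h (hstate p hσ) (hstate q hσ) ?_
    exact (noisyChannel_op_conj eAB eCD hU p σ).trans <|
      hpq ▸ (noisyChannel_op_conj eAB eCD hU q σ).symm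
  exact PauliString.eq_of_conj_eq fun X => LinearMap.congr_fun hconj X

end Distinguishability

section Decoupling

variable {S A B C D : Type*} [Fintype A] [Fintype B] [Fintype C] [Fintype D]
  [DecidableEq A] [DecidableEq B] [DecidableEq C] [DecidableEq D]
  (eAB : A ⊕ B ≃ S) (eCD : C ⊕ D ≃ S)

/-- The map `E ↦ Γ† (E ⊗ I_D ⊗ I_B̄) Γ`: the dual (Heisenberg picture) of the channel
`σ ↦ Tr_{D B̄} (Γ σ Γ†)` from `A` to `C` that is complementary to the noisy channel. It records
which observables of the lost register `C` depend on the encoded state. -/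
noncomputable def complementaryDual (U : Op S) : Op C →ₗ[ℂ] Op A where
  toFun E := (encoder eAB eCD U)ᴴ * ((E ⊗ₖ (1 : Op D)) ⊗ₖ (1 : Op B)) * encoder eAB eCD U
  map_add' E F := by
    simp only [Matrix.add_kronecker, Matrix.mul_add, Matrix.add_mul]
  map_smul' c E := by
    simp only [Matrix.smul_kronecker, Matrix.mul_smul, Matrix.smul_mul, RingHom.id_apply]

theorem complementaryDual_apply (U : Op S) (E : Op C) : complementaryDual eAB eCD U E =
    (encoder eAB eCD U)ᴴ * ((E ⊗ₖ (1 : Op D)) ⊗ₖ (1 : Op B)) * encoder eAB eCD U := rfl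

variable [Fintype S] [DecidableEq S] {U : Op S}

theorem complementaryDual_one (hU : U ∈ Matrix.unitaryGroup (Bits S) ℂ) :
    complementaryDual eAB eCD U 1 = 1 := by
  have hV := conjTranspose_reindex_mul_reindex (splitBits eCD) (splitBits eAB)
    (Matrix.mem_unitaryGroup_iff'.1 hU)
  rw [complementaryDual_apply, conjTranspose_encoder_mul_mul_encoder, Matrix.one_kronecker_one,
    Matrix.mul_one, hV, ← Matrix.one_kronecker_one (m := Bits A),
    conjTranspose_attachEPR_mul_mul_attachEPR]
  simp

theorem complementaryDual_op_eq_zero (hU : IsClifford U)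
    (hinj : Function.Injective (forwardMapD eAB eCD hU)) {r : PauliString C}
    (hr : r ≠ PauliString.id C) : complementaryDual eAB eCD U r.op = 0 := by
  obtain ⟨p, q, hq, hpq⟩ := exists_evolve_tensor_eq_of_injective hU eAB eCD hinj hr
  have hV := conjTranspose_reindex_mul_reindex (splitBits eCD) (splitBits eAB)
    (Matrix.mem_unitaryGroup_iff'.1 hU.1)
  obtain ⟨c, -, hc⟩ := (phaseEq_reindex_conj_of_evolve_tensor hU hpq).conjTranspose_mul_mul hV
  rw [complementaryDual_apply, conjTranspose_encoder_mul_mul_encoder, ← PauliString.op_id,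
    hc, Matrix.smul_kronecker, Matrix.mul_smul, Matrix.smul_mul,
    conjTranspose_attachEPR_mul_mul_attachEPR,
    PauliString.trace_op_of_ne hq, mul_zero, zero_smul, smul_zero]

theorem complementaryDual_eq_trace_smul (hU : IsClifford U)
    (hinj : Function.Injective (forwardMapD eAB eCD hU)) (E : Op C) :
    complementaryDual eAB eCD U E = (((2 : ℂ) ^ Fintype.card C)⁻¹ * E.trace) • 1 := by
  let normTrace : Op C →ₗ[ℂ] Op A :=
    (((2 : ℂ) ^ Fintype.card C)⁻¹ • Matrix.traceLinearMap (Bits C) ℂ ℂ).smulRight 1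
  suffices complementaryDual eAB eCD U = normTrace from LinearMap.congr_fun this E
  refine LinearMap.ext_on_range PauliString.span_range_op fun r => ?_
  obtain rfl | hr := eq_or_ne r (PauliString.id C)
  · rw [PauliString.op_id, complementaryDual_one eAB eCD hU.1]
    simp [normTrace]
  · rw [complementaryDual_op_eq_zero eAB eCD hU hinj hr]
    simp [normTrace, PauliString.trace_op_of_ne hr]

theorem perfectRecovery_of_forwardMapD_injective (hU : IsClifford U)
    (hinj : Function.Injective (forwardMapD eAB eCD hU)) : PerfectRecovery eAB eCD U := by
  have hKraus (c c' : Bits C) :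
      (partialBra c (encoder eAB eCD U))ᴴ * partialBra c' (encoder eAB eCD U) =
        if c = c' then ((((2 : ℝ) ^ Fintype.card C)⁻¹ : ℝ) : ℂ) • 1 else 0 := by
    rw [conjTranspose_partialBra_mul_partialBra, ← complementaryDual_apply,
      complementaryDual_eq_trace_smul eAB eCD hU hinj]
    split_ifs with h <;> simp [h]
  obtain ⟨R, hR, hRK⟩ := exists_isQuantumChannel_krausMap_leftInverse
    (fun _ => by positivity) (by simp) hKraus
  exact ⟨R, hR, fun σ _ => by rw [noisyChannel_eq_krausMap, hRK]⟩

end Decoupling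

theorem mainTheorem1 {S A B C D : Type*}
    [Fintype S] [Fintype A] [Fintype B] [Fintype C] [Fintype D]
    [DecidableEq S] [DecidableEq A] [DecidableEq B] [DecidableEq C] [DecidableEq D]
    (eAB : A ⊕ B ≃ S) (eCD : C ⊕ D ≃ S) (U : Op S) (hU : IsClifford U) :
    PerfectRecovery eAB eCD U ↔ Function.Injective (forwardMapD eAB eCD hU) :=
  ⟨fun h => forwardMapD_injective_of_injOn_noisyChannel hU h.injOn_noisyChannel,
    perfectRecovery_of_forwardMapD_injective eAB eCD hU⟩
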